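/- Let $d\ge 1$, let $S_1,S_2\subset\mathbb{R}^d$ be two concentric $(d-1)$-spheres with radii $0<r_1<r_2$, and let $S=S_1\cup S_2$. Let $\Lambda_2$ be the decision axis of $S$ in the Euclidean norm, that is, the set of all centres of closed balls whose boundary meets both $S_1$ and $S_2$ and whose interior meets neither, and let $\mathrm{rch}_2\Lambda_2=\inf_{x\in S,\,y\in\Lambda_2}\|x-y\|_2$. For $A\subset\mathbb{R}^d$ and $\epsilon\ge 0$ write $A^\epsilon=\{x:\inf_{y\in A}\|x-y\|_2\le\epsilon\}$. Let $f:\mathbb{R}^d\to\mathbb{R}$ be a fully connected neural network with ReLU activations (any depth and widths, real-valued affine output), which assigns the class of $S_1$ where $f>0$ and the class of $S_2$ where $f<0$. Let $\tau\in[0,\mathrm{rch}_2\Lambda_2]$, and suppose that $f$ correctly classifies $S^{\mathrm{rch}_2\Lambda_2-\tau}$, i.e. $f>0$ on $S_1^{\mathrm{rch}_2\Lambda_2-\tau}$ and $f<0$ on $S_2^{\mathrm{rch}_2\Lambda_2-\tau}$; or, instead, that $f>0$ on $S_1$, $f<0$ on $S_2$, and the decision boundary $\{f=0\}$ is contained in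 $\Lambda_2^\tau$. Then the number $N$ of linear regions into which $f$ subdivides $\mathbb{R}^d$ (the convex polytopes with non-empty interior consisting of the inputs that share one activation pattern of the hidden units, a unit being active when its input to the ReLU is positive) satisfies $$N\ \ge\ 2\sqrt{\pi}\,\frac{\Gamma(\frac{d+1}{2})}{\Gamma(\frac d2)}\left(\frac{r_1+\mathrm{rch}_2\Lambda_2}{4\tau}\right)^{\frac{d-1}{2}} .$$ Asymptotically, $N\in\Omega\!\left(\frac{\sqrt d}{2^d}\left(\frac{r_1+\mathrm{rch}_2\Lambda_2}{\tau}\right)^{\frac{d-1}{2}}\right)$: there is an absolute constant $C>0$, independent of $d,r_1,r_2,\tau,f$, with $N\ge C\,\frac{\sqrt d}{2^d}\left(\frac{r_1+\mathrm{rch}_2\Lambda_2}{\tau}\right)^{\frac{d-1}{2}}$. (For $\tau=0$ and $d\ge2$ the right-hand sides are read as $+\infty$, so the claim is that no such network exists; for $d=1$ the powers are read as $1$.) -/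

import Mathlib

/-! ### Geometry of class manifolds (Euclidean norm) -/

/-- The decision axis of a family of class manifolds `M i`: the centres `c` of closed balls whose
boundary meets at least two distinct classes and whose interior meets none of them. -/
def decisionAxis {E ι : Type*} [MetricSpace E] (M : ι → Set E) : Set E :=
  {c | ∃ r : ℝ, (∃ i j, i ≠ j ∧ (Metric.sphere c r ∩ M i).Nonempty ∧
      (Metric.sphere c r ∩ M j).Nonempty) ∧ Disjoint (Metric.ball c r) (⋃ i, M i)}

/-- The reach of `T` with respect to `M`: the infimum of `dist x y` over `x ∈ M`, `y ∈ T`. -/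
noncomputable def reach {E : Type*} [MetricSpace E] (T M : Set E) : ℝ :=
  sInf (Set.image2 dist M T)

/-! ### Fully connected ReLU networks -/

/-- Fully connected ReLU networks `ℝⁿ → ℝ` with any number of hidden layers of any widths: either an
affine output layer, or a hidden layer `x ↦ ReLU (W x + b)` followed by a network. -/
inductive ReLUNetwork : ℕ → Type
  | output {n : ℕ} (w : Fin n → ℝ) (b : ℝ) : ReLUNetwork n
  | hidden {n m : ℕ} (W : Matrix (Fin m) (Fin n) ℝ) (b : Fin m → ℝ) (net : ReLUNetwork m) :
      ReLUNetwork n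

namespace ReLUNetwork

/-- The function computed by a network, on coordinate vectors. -/
noncomputable def eval : {n : ℕ} → ReLUNetwork n → (Fin n → ℝ) → ℝ
  | _, output w b, x => w ⬝ᵥ x + b
  | _, hidden W b net, x => net.eval (fun i => max ((W.mulVec x + b) i) 0)

/-- The hidden units of a network. -/
def HiddenUnit : {n : ℕ} → ReLUNetwork n → Type
  | _, output _ _ => Empty
  | _, hidden (m := m) _ _ net => Fin m ⊕ net.HiddenUnit

/-- The value that a hidden unit receives (before the ReLU is applied) when the input is `x`. -/
noncomputable def preactivation :
    {n : ℕ} → (net : ReLUNetwork n) → (Fin n → ℝ) → net.HiddenUnit → ℝ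
  | _, output _ _, _ => Empty.elim
  | _, hidden W b net, x => Sum.elim (W.mulVec x + b)
      (net.preactivation (fun i => max ((W.mulVec x + b) i) 0))

/-- The function `ℝᵈ → ℝ` computed by a network. -/
noncomputable def toFun {d : ℕ} (net : ReLUNetwork d) (x : EuclideanSpace ℝ (Fin d)) : ℝ :=
  net.eval x.ofLp

/-- The activation pattern at the input `x`: the set of hidden units that are active. -/
def activationPattern {d : ℕ} (net : ReLUNetwork d) (x : EuclideanSpace ℝ (Fin d)) :
    Set net.HiddenUnit :=
  {u | 0 < net.preactivation x.ofLp u}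

/-- The linear regions of a network: the full-dimensional convex polytopes of inputs that share one
activation pattern. (The closures of these regions cover `ℝᵈ`; the lower-dimensional pattern sets
lie in their boundaries and are not counted.) -/
def linearRegions {d : ℕ} (net : ReLUNetwork d) : Set (Set (EuclideanSpace ℝ (Fin d))) :=
  {P | (∃ s : Set net.HiddenUnit, P = {x | net.activationPattern x = s}) ∧ (interior P).Nonempty}

theorem finite_hiddenUnit {n : ℕ} (net : ReLUNetwork n) : Finite net.HiddenUnit := by
  induction net with
  | output w b => exact inferInstanceAs (Finite Empty)
  | @hidden n m W b net ih =>
    have := ih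
    exact inferInstanceAs (Finite (Fin m ⊕ net.HiddenUnit))

/-- There are only finitely many linear regions, so that counting them by `Set.ncard` is
meaningful. -/
theorem finite_linearRegions {d : ℕ} (net : ReLUNetwork d) : net.linearRegions.Finite := by
  have := net.finite_hiddenUnit
  refine (Set.finite_range
    (fun s : Set net.HiddenUnit => {x | net.activationPattern x = s})).subset ?_
  rintro P ⟨⟨s, rfl⟩, -⟩
  exact ⟨s, rfl⟩

/-- The number of linear regions. -/
noncomputable def numLinearRegions {d : ℕ} (net : ReLUNetwork d) : ℕ :=
  net.linearRegions.ncard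

end ReLUNetwork

/-! ### Classification by the sign of a real-valued function -/

/-- The decision boundary of `f`. -/
def decisionBoundary {E : Type*} (f : E → ℝ) : Set E := {x | f x = 0}

/-- `f` classifies every point of `A` into the first class (`f > 0`) and every point of `B` into the
second class (`f < 0`). -/
def CorrectlyClassifies {E : Type*} (f : E → ℝ) (A B : Set E) : Prop :=
  (∀ x ∈ A, 0 < f x) ∧ ∀ x ∈ B, f x < 0

/-! The decision axis is the sphere of radius R = (r₁ + r₂)/2 about the common centre c, with reach
(r₂ - r₁)/2, so R = r₁ + ρ. Either hypothesis makes every ray from c meet the zero set of f in the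
shell R - τ ≤ ‖x - c‖ ≤ R + τ (`SeparatesInShell`).

On the closure of a linear region f is affine, so its zeros there form a closed convex set Z. If Z
meets the shell, it stays in it. The point of Z nearest to c is then the axis of a cone with apex c
that contains Z and has half-angle θ, where cos θ = (R - τ)/(R + τ)
(`Convex.exists_unit_mul_norm_le_inner`). The closures of the regions cover space, so these cones
contain all rays, and N sectors of half-angle θ cover the unit ball
(`ReLUNetwork.unitBallVolume_le`).

With V_m the volume of the unit ball in dimension m, a sector has volume at most (2 tan(θ/2))^(d-1)
V_(d-1)/d (`volume_sector_le`), because stereographic projection of its cap to the tangent plane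
does not decrease area. Since tan²(θ/2) = τ/R and d V_d / V_(d-1) is the Gamma factor of the claim
(`unitBallVolume_succ`), comparing volumes gives the bound. -/

open MeasureTheory

/-! ### Volumes of balls and spherical sectors -/

/-- The volume of the unit ball of `ℝⁿ`. -/
noncomputable def unitBallVolume (n : ℕ) : ℝ := √Real.pi ^ n / Real.Gamma ((n : ℝ) / 2 + 1)

theorem unitBallVolume_pos (n : ℕ) : 0 < unitBallVolume n := by
  have : 0 < Real.Gamma ((n : ℝ) / 2 + 1) := Real.Gamma_pos_of_pos (by positivity)
  have := Real.pi_pos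
  unfold unitBallVolume
  positivity

theorem volume_unitBall (n : ℕ) :
    volume (Metric.ball (0 : EuclideanSpace ℝ (Fin n)) 1) = ENNReal.ofReal (unitBallVolume n) := by
  rcases n with _ | n
  · have h : Metric.ball (0 : EuclideanSpace ℝ (Fin 0)) 1 = Set.univ := by
      ext x; simp [Subsingleton.elim x 0]
    have h' := (PiLp.volume_preserving_ofLp (Fin 0)).measure_preimage
      (s := Set.univ) MeasurableSet.univ.nullMeasurableSet
    rw [Set.preimage_univ] at h'
    rw [h, h']
    simp [unitBallVolume, volume_pi]
  · rw [EuclideanSpace.volume_ball]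
    simp [unitBallVolume]

theorem volume_closedBall_euclideanSpace (n : ℕ) {r : ℝ} (hr : 0 ≤ r) :
    volume (Metric.closedBall (0 : EuclideanSpace ℝ (Fin n)) r) =
      ENNReal.ofReal (r ^ n * unitBallVolume n) := by
  rw [Measure.addHaar_closedBall _ _ hr, volume_unitBall, finrank_euclideanSpace_fin,
    ENNReal.ofReal_mul (by positivity)]

theorem volume_sum_sq_le (n : ℕ) {r : ℝ} (hr : 0 ≤ r) :
    volume {y : Fin n → ℝ | ∑ i, y i ^ 2 ≤ r ^ 2} = ENNReal.ofReal (r ^ n * unitBallVolume n) := by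
  rw [← volume_closedBall_euclideanSpace n hr,
    ← (PiLp.volume_preserving_ofLp (Fin n)).measure_preimage]
  · congr 1
    ext x
    simp only [Set.mem_preimage, Set.mem_ofPred_eq, mem_closedBall_zero_iff]
    rw [← EuclideanSpace.real_norm_sq_eq, sq_le_sq₀ (norm_nonneg x) hr]
  · exact (isClosed_le (by fun_prop) continuous_const).measurableSet.nullMeasurableSet

/-- The volume integral of a spherical sector of opening angle `arccos k` is bounded by means of
the stereographic projection of its cap. -/
theorem sector_integral_le (n : ℕ) {k : ℝ} (hk : 0 < k) (hk1 : k ≤ 1) :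
    √(1 - k ^ 2) ^ n * k / (n + 1) + ∫ t in k..1, √(1 - t ^ 2) ^ n ≤
      (2 * √(1 - k ^ 2) / (1 + k)) ^ n / (n + 1) := by
  have hc : Continuous fun t : ℝ => √(1 - t ^ 2) ^ n := by fun_prop
  -- Right side minus left side as a function of c = cos θ. It is antitone and vanishes at c = 1,
  -- hence is nonnegative at k.
  set h : ℝ → ℝ := fun c => (2 * √(1 - c ^ 2) / (1 + c)) ^ n / (n + 1) -
    (√(1 - c ^ 2) ^ n * c / (n + 1) +
      ((∫ t in (0 : ℝ)..1, √(1 - t ^ 2) ^ n) - ∫ t in (0 : ℝ)..c, √(1 - t ^ 2) ^ n)) with hh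
  have hint : ∀ x, HasDerivAt (fun c : ℝ => ∫ t in (0 : ℝ)..c, √(1 - t ^ 2) ^ n)
      (√(1 - x ^ 2) ^ n) x := fun x =>
    intervalIntegral.integral_hasDerivAt_right (hc.intervalIntegrable _ _)
      (hc.stronglyMeasurableAtFilter _ _) hc.continuousAt
  have hder : ∀ x ∈ Set.Ioo (0 : ℝ) 1, ∃ y ≤ 0, HasDerivAt h y x := by
    rintro x ⟨hx0, hx1⟩
    have hw2 : 0 < 1 - x ^ 2 := by nlinarith
    have hw : 0 < √(1 - x ^ 2) := Real.sqrt_pos.2 hw2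
    have hsq : √(1 - x ^ 2) ^ 2 = 1 - x ^ 2 := Real.sq_sqrt hw2.le
    have d1 : HasDerivAt (fun c : ℝ => √(1 - c ^ 2)) (-x / √(1 - x ^ 2)) x := by
      refine (((hasDerivAt_id' x).pow 2).const_sub 1 |>.sqrt hw2.ne').congr_deriv ?_
      norm_num
      field_simp
    have d2 : HasDerivAt (fun c : ℝ => 2 * √(1 - c ^ 2) / (1 + c))
        (-(2 / (1 + x)) / √(1 - x ^ 2)) x := by
      refine ((d1.const_mul 2).div ((hasDerivAt_id' x).const_add 1)
        (by positivity)).congr_deriv ?_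
      field_simp
      rw [hsq]
      ring
    have d3 := ((d2.pow n).div_const ((n : ℝ) + 1)).sub
      ((((d1.pow n).mul (hasDerivAt_id' x)).div_const ((n : ℝ) + 1)).add
        ((hint x).const_sub (∫ t in (0 : ℝ)..1, √(1 - t ^ 2) ^ n)))
    refine ⟨_, ?_, d3⟩
    rcases n with _ | n
    · simp
    · simp only [Pi.pow_apply]
      -- 2 / (1 + x) is the conformal factor of stereographic projection at angle arccos x. That it
      -- is at least 1 gives the derivative its sign.
      have hq : 1 ≤ 2 / (1 + x) := by
        rw [le_div_iff₀ (by positivity)]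
        linarith
      set q := 2 / (1 + x)
      set w := √(1 - x ^ 2)
      have hwq : 2 * w / (1 + x) = w * q := by ring
      have hp : w ^ n ≤ w ^ n * q ^ (n + 1) :=
        le_mul_of_one_le_right (by positivity) (one_le_pow₀ hq)
      refine le_of_eq_of_le (b := -((n + 1 : ℝ) / ((n + 2) * w)) *
        (w ^ n * q ^ (n + 1) - w ^ n)) ?_ ?_
      · simp only [hwq, Nat.add_sub_cancel, mul_pow _ q, Nat.cast_add, Nat.cast_one, pow_succ w n,
          pow_succ q n]
        field_simp
        linear_combination ((n : ℝ) + 1) * (n + 2) * hsq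
      · exact mul_nonpos_of_nonpos_of_nonneg (neg_nonpos.2 (by positivity)) (by linarith)
  have hanti : AntitoneOn h (Set.Icc 0 1) := by
    refine antitoneOn_of_deriv_nonpos (convex_Icc 0 1) ?_ ?_ ?_
    · have h1 : Continuous fun c : ℝ => ∫ t in (0 : ℝ)..c, √(1 - t ^ 2) ^ n :=
        continuous_iff_continuousAt.2 fun x => (hint x).continuousAt
      refine ContinuousOn.sub (ContinuousOn.div_const (ContinuousOn.pow (ContinuousOn.div
        (by fun_prop) (by fun_prop) fun x hx => ?_) _) _) (by fun_prop)
      have := hx.1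
      positivity
    · intro x hx
      rw [interior_Icc] at hx
      obtain ⟨y, -, hy⟩ := hder x hx
      exact hy.differentiableAt.differentiableWithinAt
    · intro x hx
      rw [interior_Icc] at hx
      obtain ⟨y, hy0, hy⟩ := hder x hx
      rwa [hy.deriv]
  have h1 : h 1 = 0 := by
    simp only [hh]
    rcases n with _ | n <;> simp
  have hle := hanti ⟨hk.le, hk1⟩ ⟨zero_le_one, le_rfl⟩ hk1
  rw [h1] at hle
  simp only [hh] at hle
  rw [intervalIntegral.integral_interval_sub_left (hc.intervalIntegrable _ _)
    (hc.intervalIntegrable _ _)] at hle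
  linarith

/-- The part of the unit ball that makes an angle of at most `arccos k` with the first axis. -/
def axialSector (n : ℕ) (k : ℝ) : Set (ℝ × (Fin n → ℝ)) :=
  {q | q.1 ^ 2 + ∑ i, q.2 i ^ 2 ≤ 1 ∧ k ^ 2 * (q.1 ^ 2 + ∑ i, q.2 i ^ 2) ≤ q.1 ^ 2 ∧ 0 ≤ q.1}

theorem isClosed_axialSector (n : ℕ) (k : ℝ) : IsClosed (axialSector n k) := by
  have h1 : Continuous fun q : ℝ × (Fin n → ℝ) => q.1 ^ 2 + ∑ i, q.2 i ^ 2 := by fun_prop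
  have h2 : Continuous fun q : ℝ × (Fin n → ℝ) => q.1 := by fun_prop
  exact (isClosed_le h1 continuous_const).inter
    ((isClosed_le (h1.const_mul _) (h2.pow 2)).inter (isClosed_le continuous_const h2))

theorem volume_axialSector_le (n : ℕ) {k : ℝ} (hk : 0 < k) (hk1 : k ≤ 1) :
    volume (axialSector n k) ≤
      ENNReal.ofReal
        ((2 * √(1 - k ^ 2) / (1 + k)) ^ n / (n + 1) * unitBallVolume n) := by
  have hV := (unitBallVolume_pos n).le
  set T := axialSector n k
  have hTm : MeasurableSet T := (isClosed_axialSector n k).measurableSet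
  have hw : √(1 - k ^ 2) ^ 2 = 1 - k ^ 2 := Real.sq_sqrt (by nlinarith)
  rw [Measure.volume_eq_prod, Measure.prod_apply hTm]
  set F : ℝ → ℝ := fun t => (t * (√(1 - k ^ 2) / k)) ^ n * unitBallVolume n
  set G : ℝ → ℝ := fun t => √(1 - t ^ 2) ^ n * unitBallVolume n
  have hF : Continuous F := by fun_prop
  have hG : Continuous G := by fun_prop
  -- Below height k a slice lies in a slice of the cone, of radius t tan θ; above k, in a slice of
  -- the ball, of radius √(1 - t²).
  have hslice : ∀ t, volume (Prod.mk t ⁻¹' T) ≤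
      (Set.Icc 0 k).indicator (fun t => ENNReal.ofReal (F t)) t +
        (Set.Icc k 1).indicator (fun t => ENNReal.ofReal (G t)) t := by
    intro t
    have hout : t ∉ Set.Icc (0 : ℝ) 1 → volume (Prod.mk t ⁻¹' T) ≤ 0 := by
      intro ht
      rw [show Prod.mk t ⁻¹' T = ∅ from ?_, measure_empty]
      refine Set.eq_empty_of_forall_notMem fun y hy => ht ?_
      obtain ⟨h1, -, h3⟩ := hy
      have : 0 ≤ ∑ i, y i ^ 2 := Finset.sum_nonneg fun i _ => sq_nonneg _
      exact ⟨h3, by nlinarith⟩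
    by_cases ht : t ∈ Set.Icc (0 : ℝ) 1
    · rcases le_total t k with htk | htk
      · rw [Set.indicator_of_mem (s := Set.Icc 0 k) ⟨ht.1, htk⟩]
        refine le_trans ?_ le_self_add
        rw [← volume_sum_sq_le n (mul_nonneg ht.1 (by positivity))]
        refine measure_mono fun y (hy : (t, y) ∈ axialSector n k) => ?_
        have h2 := hy.2.1
        simp only [Set.mem_ofPred_eq, mul_pow, div_pow, hw] at h2 ⊢
        rw [← mul_div_assoc, le_div_iff₀ (by positivity)]
        linarith
      · rw [Set.indicator_of_mem (s := Set.Icc k 1) ⟨htk, ht.2⟩]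
        refine le_trans ?_ le_add_self
        rw [← volume_sum_sq_le n (Real.sqrt_nonneg _)]
        refine measure_mono fun y (hy : (t, y) ∈ axialSector n k) => ?_
        obtain ⟨h1, -, -⟩ := hy
        simp only [Set.mem_ofPred_eq] at h1 ⊢
        rw [Real.sq_sqrt (by nlinarith [ht.1, ht.2] : (0 : ℝ) ≤ 1 - t ^ 2)]
        linarith
    · exact (hout ht).trans (zero_le)
  refine (lintegral_mono hslice).trans ?_
  rw [lintegral_add_left (hF.measurable.ennreal_ofReal.indicator measurableSet_Icc),
    lintegral_indicator measurableSet_Icc, lintegral_indicator measurableSet_Icc,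
    ← ofReal_integral_eq_lintegral_ofReal (hF.integrableOn_Icc)
      ((ae_restrict_iff' measurableSet_Icc).2 (Filter.Eventually.of_forall fun t ht =>
        mul_nonneg (pow_nonneg (mul_nonneg ht.1 (by positivity)) _) hV)),
    ← ofReal_integral_eq_lintegral_ofReal (hG.integrableOn_Icc)
      (Filter.Eventually.of_forall fun t => mul_nonneg (by positivity) hV),
    integral_Icc_eq_integral_Ioc, integral_Icc_eq_integral_Ioc,
    ← intervalIntegral.integral_of_le hk.le, ← intervalIntegral.integral_of_le hk1,
    ← ENNReal.ofReal_add]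
  · refine ENNReal.ofReal_le_ofReal ?_
    simp only [F, G, intervalIntegral.integral_mul_const, mul_pow, integral_pow]
    rw [← add_mul]
    refine mul_le_mul_of_nonneg_right (le_trans (le_of_eq ?_) (sector_integral_le n hk hk1)) hV
    congr 1
    rw [zero_pow (Nat.succ_ne_zero n), div_pow, pow_succ]
    field_simp
    ring
  · exact intervalIntegral.integral_nonneg hk.le fun t ht =>
      mul_nonneg (pow_nonneg (mul_nonneg ht.1 (by positivity)) _) hV
  · exact intervalIntegral.integral_nonneg hk1 fun t ht => mul_nonneg (by positivity) hV

theorem volume_sector_le (n : ℕ) {k : ℝ} (hk : 0 < k) (hk1 : k ≤ 1)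
    (u : EuclideanSpace ℝ (Fin (n + 1))) (hu : ‖u‖ = 1) :
    volume {x | ‖x‖ ≤ 1 ∧ k * ‖x‖ ≤ inner ℝ u x} ≤
      ENNReal.ofReal
        ((2 * √(1 - k ^ 2) / (1 + k)) ^ n / (n + 1) * unitBallVolume n) := by
  refine le_trans ?_ (volume_axialSector_le n hk hk1)
  set T := axialSector n k
  have hTm : MeasurableSet T := (isClosed_axialSector n k).measurableSet
  set e : EuclideanSpace ℝ (Fin (n + 1)) := EuclideanSpace.single 0 1 with he
  -- The reflection that swaps u with the first basis vector preserves volume.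
  set ϕ := (Submodule.span ℝ {u - e})ᗮ.reflection
  have hϕ : ϕ u = e := Submodule.reflection_sub (by simp [hu, he])
  have mp := ((volume_preserving_piFinSuccAbove (fun _ : Fin (n + 1) => ℝ) 0).comp
    (PiLp.volume_preserving_ofLp (Fin (n + 1)))).comp ϕ.measurePreserving
  rw [← mp.measure_preimage hTm.nullMeasurableSet]
  refine measure_mono fun x ⟨hx1, hx2⟩ => ?_
  rw [← ϕ.norm_map] at hx1 hx2
  rw [← ϕ.inner_map_map, hϕ, he, EuclideanSpace.inner_single_left] at hx2
  simp only [map_one, one_mul] at hx2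
  have hsum : ‖ϕ x‖ ^ 2 = (ϕ x) 0 ^ 2 + ∑ i : Fin n, (ϕ x) i.succ ^ 2 := by
    rw [EuclideanSpace.real_norm_sq_eq, Fin.sum_univ_succ]
  have h0 : 0 ≤ k * ‖ϕ x‖ := by positivity
  change (ϕ x) 0 ^ 2 + ∑ i : Fin n, (ϕ x) ((0 : Fin (n + 1)).succAbove i) ^ 2 ≤ 1 ∧
    k ^ 2 * ((ϕ x) 0 ^ 2 + ∑ i : Fin n, (ϕ x) ((0 : Fin (n + 1)).succAbove i) ^ 2) ≤
      (ϕ x) 0 ^ 2 ∧ 0 ≤ (ϕ x) 0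
  simp only [Fin.zero_succAbove]
  rw [← hsum, ← mul_pow]
  exact ⟨pow_le_one₀ (norm_nonneg _) hx1, pow_le_pow_left₀ h0 hx2 2, h0.trans hx2⟩

/-! ### Convexity and covering properties of linear regions -/

namespace ReLUNetwork

/-- A ReLU network is affine along segments between inputs with the same activation pattern. -/
theorem preactivation_eval_convexCombo {n : ℕ} (net : ReLUNetwork n) (x y : Fin n → ℝ)
    (hxy : ∀ u, 0 < net.preactivation x u ↔ 0 < net.preactivation y u) {a b : ℝ} (ha : 0 ≤ a)
    (hb : 0 ≤ b) (hab : a + b = 1) :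
    (∀ u, net.preactivation (a • x + b • y) u =
        a * net.preactivation x u + b * net.preactivation y u) ∧
      net.eval (a • x + b • y) = a * net.eval x + b * net.eval y := by
  induction net with
  | output w c =>
    refine ⟨fun u => u.elim, ?_⟩
    simp only [eval, dotProduct_add, dotProduct_smul, smul_eq_mul]
    linear_combination (-c) * hab
  | @hidden n m W c net ih =>
    have hlin : ∀ i, (W.mulVec (a • x + b • y) + c) i =
        a * (W.mulVec x + c) i + b * (W.mulVec y + c) i := by
      intro i
      simp only [Matrix.mulVec_add, Matrix.mulVec_smul, Pi.add_apply, Pi.smul_apply, smul_eq_mul]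
      linear_combination (-c i) * hab
    have hrelu : (fun i => max ((W.mulVec (a • x + b • y) + c) i) 0) =
        a • (fun i => max ((W.mulVec x + c) i) 0) + b • (fun i => max ((W.mulVec y + c) i) 0) := by
      funext i
      have hi : 0 < (W.mulVec x + c) i ↔ 0 < (W.mulVec y + c) i := hxy (Sum.inl i)
      simp only [hlin, Pi.add_apply (a • _), Pi.smul_apply, smul_eq_mul]
      by_cases h : 0 < (W.mulVec x + c) i
      · have h' := hi.1 h
        rw [max_eq_left h.le, max_eq_left h'.le, max_eq_left (by positivity)]
      · have h' := mt hi.2 h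
        rw [not_lt] at h h'
        rw [max_eq_right h, max_eq_right h', max_eq_right]
        · simp
        · nlinarith
    have hih := ih _ _ fun u => hxy (Sum.inr u)
    rw [← hrelu] at hih
    exact ⟨Sum.rec hlin hih.1, hih.2⟩

theorem continuous_eval {n : ℕ} (net : ReLUNetwork n) : Continuous net.eval := by
  induction net with
  | output w c =>
    simp only [eval, dotProduct]
    fun_prop
  | hidden W c net ih =>
    refine ih.comp (continuous_pi fun i => ?_)
    have : Continuous fun x => (W.mulVec x + c) i := by
      simp only [Matrix.mulVec, dotProduct, Pi.add_apply]
      fun_prop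
    exact this.max continuous_const

variable {d : ℕ} (net : ReLUNetwork d)

theorem continuous_toFun : Continuous net.toFun :=
  net.continuous_eval.comp (PiLp.continuous_ofLp _ _)

/-- The set of inputs with a given activation pattern. -/
def patternCell (s : Set net.HiddenUnit) : Set (EuclideanSpace ℝ (Fin d)) :=
  {x | net.activationPattern x = s}

theorem preactivation_pos_iff {s : Set net.HiddenUnit} {x y : EuclideanSpace ℝ (Fin d)}
    (hx : x ∈ net.patternCell s) (hy : y ∈ net.patternCell s) (u : net.HiddenUnit) :
    0 < net.preactivation x.ofLp u ↔ 0 < net.preactivation y.ofLp u := by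
  have h : net.activationPattern x = net.activationPattern y := Eq.trans hx (Eq.symm hy)
  exact Set.ext_iff.1 h u

theorem convex_patternCell (s : Set net.HiddenUnit) : Convex ℝ (net.patternCell s) := by
  intro x hx y hy a b ha hb hab
  have hiff := net.preactivation_pos_iff hx hy
  have h := (net.preactivation_eval_convexCombo x.ofLp y.ofLp hiff ha hb hab).1
  refine Eq.trans (Set.ext fun u => ?_) hx
  change 0 < net.preactivation (a • x.ofLp + b • y.ofLp) u ↔ 0 < net.preactivation x.ofLp u
  rw [h]
  constructor
  · intro hpos
    by_contra hneg
    have h1 := not_lt.1 hneg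
    have h2 := not_lt.1 (mt (hiff u).2 hneg)
    nlinarith
  · intro h1
    have h2 := (hiff u).1 h1
    rcases ha.eq_or_lt with rfl | ha
    · obtain rfl : b = 1 := by linarith
      linarith
    · have := mul_pos ha h1
      have := mul_nonneg hb h2.le
      linarith

/-- Affinity on a cell passes to its closure by continuity of the network. -/
theorem toFun_convexCombo_of_mem_closure {s : Set net.HiddenUnit}
    {x y : EuclideanSpace ℝ (Fin d)} (hx : x ∈ closure (net.patternCell s))
    (hy : y ∈ closure (net.patternCell s)) {a b : ℝ} (ha : 0 ≤ a) (hb : 0 ≤ b)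
    (hab : a + b = 1) :
    net.toFun (a • x + b • y) = a * net.toFun x + b * net.toFun y := by
  have hc := net.continuous_toFun
  have hmem : (x, y) ∈ closure (net.patternCell s ×ˢ net.patternCell s) := by
    rw [closure_prod_eq]
    exact ⟨hx, hy⟩
  have hcl : IsClosed {q : EuclideanSpace ℝ (Fin d) × EuclideanSpace ℝ (Fin d) |
      net.toFun (a • q.1 + b • q.2) = a * net.toFun q.1 + b * net.toFun q.2} :=
    isClosed_eq (by fun_prop) (by fun_prop)
  refine closure_minimal ?_ hcl hmem
  rintro ⟨x', y'⟩ ⟨hx', hy'⟩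
  exact (net.preactivation_eval_convexCombo x'.ofLp y'.ofLp
    (net.preactivation_pos_iff hx' hy') ha hb hab).2

/-- The part of the decision boundary in the closure of a linear region is convex. -/
theorem convex_closure_inter_decisionBoundary {P : Set (EuclideanSpace ℝ (Fin d))}
    (hP : P ∈ net.linearRegions) : Convex ℝ (closure P ∩ decisionBoundary net.toFun) := by
  obtain ⟨⟨s, rfl⟩, -⟩ := hP
  intro x hx y hy a b ha hb hab
  refine ⟨(net.convex_patternCell s).closure hx.1 hy.1 ha hb hab, ?_⟩
  have hx0 : net.toFun x = 0 := hx.2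
  have hy0 : net.toFun y = 0 := hy.2
  change net.toFun _ = 0
  rw [net.toFun_convexCombo_of_mem_closure hx.1 hy.1 ha hb hab, hx0, hy0]
  simp

theorem isClosed_closure_inter_decisionBoundary (P : Set (EuclideanSpace ℝ (Fin d))) :
    IsClosed (closure P ∩ decisionBoundary net.toFun) :=
  isClosed_closure.inter (isClosed_eq net.continuous_toFun continuous_const)

/-- A cell with empty interior is convex and lies in its own frontier, so it is null. Almost every
point is therefore in a linear region, such points are dense, and closure commutes with the finite
union. -/
theorem exists_linearRegion_mem_closure (x : EuclideanSpace ℝ (Fin d)) :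
    ∃ P ∈ net.linearRegions, x ∈ closure P := by
  have := net.finite_hiddenUnit
  have hnull : ∀ s, net.patternCell s ∉ net.linearRegions → volume (net.patternCell s) = 0 := by
    intro s hs
    have hint : interior (net.patternCell s) = ∅ :=
      Set.not_nonempty_iff_eq_empty.1 fun h => hs ⟨⟨s, rfl⟩, h⟩
    refine measure_mono_null ?_ ((net.convex_patternCell s).addHaar_frontier volume)
    rw [frontier, hint, Set.sdiff_empty]
    exact subset_closure
  have hae : ∀ᵐ y : EuclideanSpace ℝ (Fin d), ∃ P ∈ net.linearRegions, y ∈ P := by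
    refine measure_mono_null (t := ⋃ s ∈ {s | net.patternCell s ∉ net.linearRegions},
      net.patternCell s) ?_ ((measure_biUnion_null_iff (Set.to_countable _)).2 hnull)
    intro y hy
    exact Set.mem_biUnion (x := net.activationPattern y)
      (fun h => hy ⟨_, h, rfl⟩) rfl
  have hd := Measure.dense_of_ae hae x
  rw [show {y | ∃ P ∈ net.linearRegions, y ∈ P} = ⋃ P ∈ net.linearRegions, P by ext; simp,
    net.finite_linearRegions.closure_biUnion] at hd
  simpa using hd

end ReLUNetwork

/-! ### Convex zero sets in a shell and the covering argument -/

/-- Seen from `c`, a closed convex set in the shell `a ≤ ‖z - c‖ ≤ b` lies in a cone of opening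
angle `arccos (a / b)`. -/
theorem Convex.exists_unit_mul_norm_le_inner {E : Type*} [NormedAddCommGroup E]
    [InnerProductSpace ℝ E] [CompleteSpace E] {Z : Set E} (hZ : Convex ℝ Z) (hZc : IsClosed Z)
    (hZn : Z.Nonempty) {c : E} {a b : ℝ} (ha : 0 < a) (hab : a ≤ b)
    (h : ∀ z ∈ Z, ‖z - c‖ ∈ Set.Icc a b) :
    ∃ u : E, ‖u‖ = 1 ∧ ∀ z ∈ Z, a / b * ‖z - c‖ ≤ inner ℝ u (z - c) := by
  obtain ⟨p, hp, hmin⟩ := exists_norm_eq_iInf_of_complete_convex hZn hZc.isComplete hZ c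
  rw [norm_eq_iInf_iff_real_inner_le_zero hZ hp] at hmin
  have hb : 0 < b := ha.trans_le hab
  have hpa := (h p hp).1
  have hp0 : 0 < ‖p - c‖ := ha.trans_le hpa
  refine ⟨‖p - c‖⁻¹ • (p - c), norm_smul_inv_norm (norm_pos_iff.1 hp0), fun z hz => ?_⟩
  have h1 : ‖p - c‖ ^ 2 ≤ inner ℝ (p - c) (z - c) := by
    have h2 := hmin z hz
    rw [← neg_sub p c, inner_neg_left, show z - p = (z - c) - (p - c) by abel, inner_sub_right,
      real_inner_self_eq_norm_sq] at h2
    linarith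
  rw [real_inner_smul_left]
  calc a / b * ‖z - c‖ ≤ a / b * b := by
        gcongr
        exact (h z hz).2
    _ = a := by field_simp
    _ ≤ ‖p - c‖ := hpa
    _ = ‖p - c‖⁻¹ * ‖p - c‖ ^ 2 := by field_simp
    _ ≤ _ := by gcongr

/-- Each ray from `c` meets the zero set of `f` in the shell `a ≤ ‖x - c‖ ≤ b`, and convex sets of
zeros do not leave that shell. -/
structure SeparatesInShell {E : Type*} [NormedAddCommGroup E] [NormedSpace ℝ E] (f : E → ℝ)
    (c : E) (a b : ℝ) : Prop where
  exists_zero : ∀ v : E, ‖v‖ = 1 → ∃ t ∈ Set.Icc a b, f (c + t • v) = 0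
  mem_shell : ∀ Z : Set E, Convex ℝ Z → Z ⊆ decisionBoundary f → ∀ z ∈ Z,
    ‖z - c‖ ∈ Set.Icc a b → ∀ z' ∈ Z, ‖z' - c‖ ∈ Set.Icc a b

theorem norm_add_smul_sub {E : Type*} [NormedAddCommGroup E] [NormedSpace ℝ E] (c : E) {v : E}
    (hv : ‖v‖ = 1) {t : ℝ} (ht : 0 ≤ t) : ‖c + t • v - c‖ = t := by
  rw [add_sub_cancel_left, norm_smul, hv, mul_one, Real.norm_of_nonneg ht]

theorem exists_zero_on_ray {E : Type*} [NormedAddCommGroup E] [NormedSpace ℝ E] {f : E → ℝ}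
    (hf : Continuous f) {c v : E} (hv : ‖v‖ = 1) {a b : ℝ} (ha : 0 ≤ a) (hab : a ≤ b)
    (hfa : ∀ x, ‖x - c‖ = a → 0 < f x) (hfb : ∀ x, ‖x - c‖ = b → f x < 0) :
    ∃ t ∈ Set.Icc a b, f (c + t • v) = 0 := by
  have hg : Continuous fun t : ℝ => f (c + t • v) := by fun_prop
  exact intermediate_value_Icc' hab hg.continuousOn
    ⟨(hfb _ (norm_add_smul_sub c hv (ha.trans hab))).le, (hfa _ (norm_add_smul_sub c hv ha)).le⟩

/-- The zero set may have pieces outside the shell, but a connected set of zeros cannot cross the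
two bounding spheres, where f does not vanish. -/
theorem SeparatesInShell.of_sign {E : Type*} [NormedAddCommGroup E] [NormedSpace ℝ E] {f : E → ℝ}
    (hf : Continuous f) {c : E} {a b : ℝ} (ha : 0 ≤ a) (hab : a ≤ b)
    (hfa : ∀ x, ‖x - c‖ = a → 0 < f x) (hfb : ∀ x, ‖x - c‖ = b → f x < 0) :
    SeparatesInShell f c a b := by
  refine ⟨fun v hv => exists_zero_on_ray hf hv ha hab hfa hfb, ?_⟩
  intro Z hZ hZf z hz hzab z' hz'
  have hconn : ((fun x => ‖x - c‖) '' Z).OrdConnected :=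
    (hZ.isPreconnected.image _ (by fun_prop)).ordConnected
  have hzi := Set.mem_image_of_mem (fun x => ‖x - c‖) hz
  have hzi' := Set.mem_image_of_mem (fun x => ‖x - c‖) hz'
  constructor
  · by_contra! hlt
    obtain ⟨x, hx, hxa⟩ := hconn.out hzi' hzi ⟨hlt.le, hzab.1⟩
    exact (hfa x hxa).ne' (hZf hx)
  · by_contra! hlt
    obtain ⟨x, hx, hxb⟩ := hconn.out hzi hzi' ⟨hzab.2, hlt.le⟩
    exact (hfb x hxb).ne (hZf hx)

theorem ReLUNetwork.unitBallVolume_le {n : ℕ} (net : ReLUNetwork (n + 1))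
    {c : EuclideanSpace ℝ (Fin (n + 1))} {a b : ℝ} (ha : 0 < a) (hab : a ≤ b)
    (h : SeparatesInShell net.toFun c a b) :
    unitBallVolume (n + 1) ≤ net.numLinearRegions *
      ((2 * √(1 - (a / b) ^ 2) / (1 + a / b)) ^ n / (n + 1) * unitBallVolume n) := by
  have hb : 0 < b := ha.trans_le hab
  have hcone : ∀ P, ∃ u : EuclideanSpace ℝ (Fin (n + 1)), ‖u‖ = 1 ∧ (P ∈ net.linearRegions →
      ∀ z ∈ closure P ∩ decisionBoundary net.toFun, ‖z - c‖ ∈ Set.Icc a b →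
        a / b * ‖z - c‖ ≤ inner ℝ u (z - c)) := by
    intro P
    by_cases hP : P ∈ net.linearRegions ∧
      ∃ z ∈ closure P ∩ decisionBoundary net.toFun, ‖z - c‖ ∈ Set.Icc a b
    · obtain ⟨hP, z, hz, hzab⟩ := hP
      have hconv := net.convex_closure_inter_decisionBoundary hP
      obtain ⟨u, hu, hu'⟩ := hconv.exists_unit_mul_norm_le_inner
        (net.isClosed_closure_inter_decisionBoundary P) ⟨z, hz⟩ ha hab
        (h.mem_shell _ hconv Set.inter_subset_right z hz hzab)
      exact ⟨u, hu, fun _ z hz _ => hu' z hz⟩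
    -- A region with no zeros in the shell gets an arbitrary axis; the cone condition is vacuous for
    -- it.
    · exact ⟨EuclideanSpace.single 0 1, by simp, fun hP' z hz hzab => (hP ⟨hP', z, hz, hzab⟩).elim⟩
  choose u hu hcap using hcone
  set R := net.finite_linearRegions.toFinset with hR
  have hcover : Metric.ball (0 : EuclideanSpace ℝ (Fin (n + 1))) 1 ⊆
      ⋃ P ∈ R, {x | ‖x‖ ≤ 1 ∧ a / b * ‖x‖ ≤ inner ℝ (u P) x} := by
    intro x hx
    rw [mem_ball_zero_iff] at hx
    simp only [Set.mem_iUnion, hR, Set.Finite.mem_toFinset]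
    by_cases hx0 : x = 0
    · obtain ⟨P, hP, -⟩ := net.exists_linearRegion_mem_closure 0
      exact ⟨P, hP, by simp [hx0]⟩
    have hxn : 0 < ‖x‖ := norm_pos_iff.2 hx0
    have hv : ‖‖x‖⁻¹ • x‖ = 1 := norm_smul_inv_norm hx0
    obtain ⟨t, ht, hzero⟩ := h.exists_zero _ hv
    obtain ⟨P, hP, hmem⟩ := net.exists_linearRegion_mem_closure (c + t • ‖x‖⁻¹ • x)
    have ht0 : 0 < t := ha.trans_le ht.1
    have hnorm := norm_add_smul_sub c hv ht0.le
    have hle := hcap P hP _ ⟨hmem, hzero⟩ (by rwa [hnorm])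
    rw [hnorm, add_sub_cancel_left, real_inner_smul_right, real_inner_smul_right] at hle
    refine ⟨P, hP, hx.le, ?_⟩
    have h1 : t / ‖x‖ * (a / b * ‖x‖) ≤ t / ‖x‖ * inner ℝ (u P) x := by
      convert hle using 1 <;> field_simp
    exact le_of_mul_le_mul_left h1 (by positivity)
  have hk1 : a / b ≤ 1 := (div_le_one hb).2 hab
  have hvol := (measure_mono hcover).trans ((measure_biUnion_finset_le (μ := volume) R _).trans
    (Finset.sum_le_sum fun P _ => volume_sector_le n (div_pos ha hb) hk1 (u P) (hu P)))
  have := (unitBallVolume_pos n).le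
  rw [volume_unitBall, Finset.sum_const, nsmul_eq_mul, ← ENNReal.ofReal_natCast,
    ← ENNReal.ofReal_mul (by positivity), ENNReal.ofReal_le_ofReal_iff (by positivity)] at hvol
  rwa [ReLUNetwork.numLinearRegions, Set.ncard_eq_toFinset_card _ net.finite_linearRegions]

/-! ### Gamma function identities and estimates -/

theorem unitBallVolume_succ (n : ℕ) :
    (n + 1) * unitBallVolume (n + 1) =
      2 * √Real.pi * (Real.Gamma (((n + 1 : ℕ) + 1 : ℝ) / 2) / Real.Gamma ((n + 1 : ℕ) / 2 : ℝ)) *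
        unitBallVolume n := by
  have h1 : Real.Gamma ((n + 1 : ℕ) / 2 + 1 : ℝ) =
      (n + 1 : ℕ) / 2 * Real.Gamma ((n + 1 : ℕ) / 2 : ℝ) := Real.Gamma_add_one (by positivity)
  have h2 : (((n + 1 : ℕ) : ℝ) + 1) / 2 = n / 2 + 1 := by
    push_cast
    ring
  have h3 : 0 < Real.Gamma ((n + 1 : ℕ) / 2 : ℝ) := Real.Gamma_pos_of_pos (by positivity)
  have h4 : 0 < Real.Gamma (n / 2 + 1 : ℝ) := Real.Gamma_pos_of_pos (by positivity)
  rw [unitBallVolume, unitBallVolume, h1, h2]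
  generalize Real.Gamma ((n + 1 : ℕ) / 2 : ℝ) = x at *
  push_cast
  field_simp
  ring

/-- With x = d/2, log-convexity at the midpoint gives Γ(x + 1) ≤ √(Γ(x + 1/2) Γ(x + 3/2)) = √(x +
1/2) Γ(x + 1/2). The ratio is thus at least x/√(x + 1/2), which is at least √(2x)/2 because x ≥ 1/2.
-/
theorem sqrt_div_two_le_Gamma_div_Gamma {d : ℕ} (hd : 1 ≤ d) :
    √(d : ℝ) / 2 ≤ Real.Gamma (((d : ℝ) + 1) / 2) / Real.Gamma ((d : ℝ) / 2) := by
  have hd' : (1 : ℝ) ≤ d := by exact_mod_cast hd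
  obtain ⟨x, hx⟩ : ∃ x : ℝ, x = d / 2 := ⟨_, rfl⟩
  have hx2 : 1 / 2 ≤ x := by linarith
  rw [show ((d : ℝ) + 1) / 2 = x + 1 / 2 by linarith, ← hx]
  have hg := Real.Gamma_mul_add_mul_le_rpow_Gamma_mul_rpow_Gamma (s := x + 1 / 2)
    (t := x + 1 / 2 + 1) (a := 1 / 2) (b := 1 / 2) (by linarith) (by linarith) (by norm_num)
    (by norm_num) (by norm_num)
  rw [show 1 / 2 * (x + 1 / 2) + 1 / 2 * (x + 1 / 2 + 1) = x + 1 by ring,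
    Real.Gamma_add_one (by linarith : x ≠ 0), Real.Gamma_add_one (by linarith : x + 1 / 2 ≠ 0),
    ← Real.sqrt_eq_rpow, ← Real.sqrt_eq_rpow] at hg
  have hG : 0 < Real.Gamma x := Real.Gamma_pos_of_pos (by linarith)
  have hG' : 0 < Real.Gamma (x + 1 / 2) := Real.Gamma_pos_of_pos (by linarith)
  rw [Real.sqrt_mul (by linarith), mul_left_comm, Real.mul_self_sqrt hG'.le] at hg
  have hs : 0 < √(x + 1 / 2) := Real.sqrt_pos.2 (by linarith)
  have h1 : x / √(x + 1 / 2) ≤ Real.Gamma (x + 1 / 2) / Real.Gamma x := by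
    rw [div_le_div_iff₀ hs hG]
    linarith
  refine le_trans ?_ h1
  rw [div_le_div_iff₀ two_pos hs, ← Real.sqrt_mul (by positivity)]
  refine Real.sqrt_le_iff.2 ⟨by linarith, ?_⟩
  rw [show (d : ℝ) = 2 * x by linarith]
  nlinarith

/-! ### Geometry of two concentric spheres -/

theorem decisionAxis_sphere_sphere {d : ℕ} (hd : 1 ≤ d) (c : EuclideanSpace ℝ (Fin d))
    {r₁ r₂ : ℝ} (h₁ : 0 < r₁) (h₂ : r₁ < r₂) :
    decisionAxis ![Metric.sphere c r₁, Metric.sphere c r₂] = Metric.sphere c ((r₁ + r₂) / 2) := by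
  obtain ⟨e, he⟩ : ∃ e : EuclideanSpace ℝ (Fin d), ‖e‖ = 1 :=
    ⟨EuclideanSpace.single ⟨0, hd⟩ 1, by simp⟩
  have hray : ∀ x : EuclideanSpace ℝ (Fin d), ∃ v, ‖v‖ = 1 ∧ x = c + ‖x - c‖ • v := by
    intro x
    by_cases hx : x - c = 0
    · exact ⟨e, he, by simp [sub_eq_zero.1 hx]⟩
    · refine ⟨‖x - c‖⁻¹ • (x - c), norm_smul_inv_norm hx, ?_⟩
      rw [smul_inv_smul₀ (norm_ne_zero_iff.2 hx)]
      abel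
  have hdist : ∀ {v : EuclideanSpace ℝ (Fin d)} (s t : ℝ), ‖v‖ = 1 →
      dist (c + s • v) (c + t • v) = |s - t| := by
    intro v s t hv
    rw [dist_add_left, dist_eq_norm, ← sub_smul, norm_smul, hv, mul_one, Real.norm_eq_abs]
  have hmem : ∀ {v : EuclideanSpace ℝ (Fin d)} {t : ℝ}, ‖v‖ = 1 → 0 ≤ t →
      c + t • v ∈ Metric.sphere c t := fun hv ht =>
    mem_sphere_iff_norm.2 (norm_add_smul_sub c hv ht)
  have hlow : ∀ {x y : EuclideanSpace ℝ (Fin d)} {t : ℝ}, y ∈ Metric.sphere c t →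
      |‖x - c‖ - t| ≤ dist y x := by
    intro x y t hy
    have := abs_norm_sub_norm_le (x - c) (y - c)
    rwa [sub_sub_sub_cancel_right, mem_sphere_iff_norm.1 hy, norm_sub_rev x y,
      ← dist_eq_norm] at this
  have hunion : ⋃ i, (![Metric.sphere c r₁, Metric.sphere c r₂] : Fin 2 → Set _) i =
      Metric.sphere c r₁ ∪ Metric.sphere c r₂ := by
    ext; simp
  ext x
  obtain ⟨v, hv, hxv⟩ := hray x
  set m := ‖x - c‖ with hm
  have hm0 : 0 ≤ m := norm_nonneg _
  rw [mem_sphere_iff_norm, ← hm]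
  simp only [decisionAxis, hunion]
  constructor
  · rintro ⟨r, ⟨i, j, hij, hi, hj⟩, hdis⟩
    have key : (Metric.sphere x r ∩ Metric.sphere c r₁).Nonempty ∧
        (Metric.sphere x r ∩ Metric.sphere c r₂).Nonempty := by
      fin_cases i <;> fin_cases j
      · exact absurd rfl hij
      · exact ⟨hi, hj⟩
      · exact ⟨hj, hi⟩
      · exact absurd rfl hij
    obtain ⟨⟨y₁, hy₁, hy₁'⟩, ⟨y₂, hy₂, hy₂'⟩⟩ := key
    -- Touching a sphere bounds r below by the distance from x to it, and the empty interior bounds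
    -- r above by it. So x is equidistant from both spheres.
    have hr1 := hlow (x := x) hy₁'
    have hr2 := hlow (x := x) hy₂'
    rw [Metric.mem_sphere.1 hy₁] at hr1
    rw [Metric.mem_sphere.1 hy₂] at hr2
    have hs1 : r ≤ |r₁ - m| := by
      rw [← hdist r₁ m hv, ← hxv, ← not_lt]
      exact fun hlt => Set.disjoint_left.1 hdis hlt (Or.inl (hmem hv h₁.le))
    have hs2 : r ≤ |r₂ - m| := by
      rw [← hdist r₂ m hv, ← hxv, ← not_lt]
      exact fun hlt => Set.disjoint_left.1 hdis hlt (Or.inr (hmem hv (h₁.trans h₂).le))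
    rw [abs_sub_comm] at hr1 hr2
    have e : |r₁ - m| = |r₂ - m| := by linarith
    rcases abs_eq_abs.1 e with h | h <;> linarith
  · intro hmx
    have e1 : |r₁ - m| = (r₂ - r₁) / 2 := by
      rw [hmx, abs_of_neg (by linarith)]
      ring
    have e2 : |r₂ - m| = (r₂ - r₁) / 2 := by
      rw [hmx, abs_of_pos (by linarith)]
      ring
    refine ⟨(r₂ - r₁) / 2, ⟨0, 1, by simp, ⟨c + r₁ • v, ?_, hmem hv h₁.le⟩,
      ⟨c + r₂ • v, ?_, hmem hv (h₁.trans h₂).le⟩⟩, ?_⟩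
    · rw [Metric.mem_sphere, hxv, hdist _ _ hv, e1]
    · rw [Metric.mem_sphere, hxv, hdist _ _ hv, e2]
    · rw [Set.disjoint_left]
      rintro y hy (hy' | hy') <;> have hl := hlow (x := x) hy' <;> rw [Metric.mem_ball] at hy <;>
        rw [abs_sub_comm, ← hm] at hl <;> linarith

theorem reach_sphere_sphere {d : ℕ} (hd : 1 ≤ d) (c : EuclideanSpace ℝ (Fin d))
    {r₁ r₂ : ℝ} (h₁ : 0 < r₁) (h₂ : r₁ < r₂) :
    reach (Metric.sphere c ((r₁ + r₂) / 2)) (Metric.sphere c r₁ ∪ Metric.sphere c r₂) =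
      (r₂ - r₁) / 2 := by
  obtain ⟨e, he⟩ : ∃ e : EuclideanSpace ℝ (Fin d), ‖e‖ = 1 :=
    ⟨EuclideanSpace.single ⟨0, hd⟩ 1, by simp⟩
  refine IsLeast.csInf_eq ⟨?_, ?_⟩
  · refine ⟨c + r₁ • e, Or.inl (mem_sphere_iff_norm.2 (norm_add_smul_sub c he h₁.le)),
      c + ((r₁ + r₂) / 2) • e,
      mem_sphere_iff_norm.2 (norm_add_smul_sub c he (by linarith)), ?_⟩
    rw [dist_add_left, dist_eq_norm, ← sub_smul, norm_smul, he, mul_one, Real.norm_eq_abs,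
      abs_of_neg (by linarith)]
    ring
  · rintro _ ⟨x, hx, y, hy, rfl⟩
    have h3 := dist_triangle x y c
    have h4 := dist_triangle_left y c x
    rw [Metric.mem_sphere.1 hy] at h3 h4
    rcases hx with hx | hx <;> rw [Metric.mem_sphere.1 hx] at h3 h4 <;> linarith

theorem SeparatesInShell.of_correctlyClassifies {d : ℕ}
    {c : EuclideanSpace ℝ (Fin d)} {r₁ r₂ τ : ℝ} (h₁ : 0 < r₁) (h₂ : r₁ < r₂) (hτ : 0 ≤ τ)
    (hτρ : τ ≤ (r₂ - r₁) / 2) {f : EuclideanSpace ℝ (Fin d) → ℝ} (hf : Continuous f)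
    (h : CorrectlyClassifies f
          (Metric.cthickening ((r₂ - r₁) / 2 - τ) (Metric.sphere c r₁))
          (Metric.cthickening ((r₂ - r₁) / 2 - τ) (Metric.sphere c r₂)) ∨
        (CorrectlyClassifies f (Metric.sphere c r₁) (Metric.sphere c r₂) ∧
          decisionBoundary f ⊆ Metric.cthickening τ (Metric.sphere c ((r₁ + r₂) / 2)))) :
    SeparatesInShell f c ((r₁ + r₂) / 2 - τ) ((r₁ + r₂) / 2 + τ) := by
  rcases h with ⟨hpos, hneg⟩ | ⟨⟨hpos, hneg⟩, hsub⟩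
  · have hthick : ∀ {x : EuclideanSpace ℝ (Fin d)} {r s : ℝ}, 0 ≤ r → 0 < ‖x - c‖ →
        |‖x - c‖ - r| ≤ s → x ∈ Metric.cthickening s (Metric.sphere c r) := by
      intro x r s hr hx hs
      have hv : ‖‖x - c‖⁻¹ • (x - c)‖ = 1 := norm_smul_inv_norm (norm_pos_iff.1 hx)
      refine Metric.mem_cthickening_of_dist_le x (c + r • ‖x - c‖⁻¹ • (x - c)) _ _
        (mem_sphere_iff_norm.2 (norm_add_smul_sub c hv hr)) ?_
      have hx' : x = c + ‖x - c‖ • ‖x - c‖⁻¹ • (x - c) := by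
        rw [smul_inv_smul₀ hx.ne']
        abel
      conv_lhs => enter [1]; rw [hx']
      rwa [dist_add_left, dist_eq_norm, ← sub_smul, norm_smul, hv, mul_one, Real.norm_eq_abs]
    -- The inner sphere of the shell has radius r₁ + (ρ - τ) and the outer one r₂ - (ρ - τ): both
    -- lie in the correctly classified thickenings.
    refine .of_sign hf (by linarith) (by linarith) (fun x hx => hpos x ?_) fun x hx => hneg x ?_
    · refine hthick h₁.le (by linarith) (abs_le.2 ⟨?_, ?_⟩) <;> linarith
    · refine hthick (by linarith) (by linarith) (abs_le.2 ⟨?_, ?_⟩) <;> linarith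
  · have hshell : ∀ x ∈ decisionBoundary f,
        ‖x - c‖ ∈ Set.Icc ((r₁ + r₂) / 2 - τ) ((r₁ + r₂) / 2 + τ) := by
      intro x hx
      have hmem := hsub hx
      rw [(isCompact_sphere c _).cthickening_eq_biUnion_closedBall hτ] at hmem
      simp only [Set.mem_iUnion] at hmem
      obtain ⟨y, hy, hxy⟩ := hmem
      rw [Metric.mem_closedBall] at hxy
      have h3 := dist_triangle x y c
      have h4 := dist_triangle_left y c x
      rw [Metric.mem_sphere.1 hy] at h3 h4
      rw [← dist_eq_norm]
      constructor <;> linarith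
    refine ⟨fun v hv => ?_, fun Z _ hZ _ _ _ z' hz' => hshell z' (hZ hz')⟩
    obtain ⟨t, ht, h0⟩ := exists_zero_on_ray hf (c := c) hv h₁.le h₂.le
      (fun x hx => hpos x (mem_sphere_iff_norm.2 hx)) fun x hx => hneg x (mem_sphere_iff_norm.2 hx)
    refine ⟨t, ?_, h0⟩
    have := hshell _ h0
    rwa [norm_add_smul_sub c hv (h₁.le.trans ht.1)] at this

/-! ### The lower bound -/

/-- Half-angle formula: for k = cos θ the left side is 2 tan(θ/2), and tan²(θ/2) = (1 - k)/(1 + k) =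
τ/R. -/
theorem two_mul_sqrt_div_of_ratio {R τ : ℝ} (hτ : 0 ≤ τ) (hR : τ < R) :
    2 * √(1 - ((R - τ) / (R + τ)) ^ 2) / (1 + (R - τ) / (R + τ)) = 2 * √(τ / R) := by
  have hR0 : 0 < R := hτ.trans_lt hR
  have h1 : 1 + (R - τ) / (R + τ) = 2 * R / (R + τ) := by
    field_simp
    ring
  have h2 : 1 - ((R - τ) / (R + τ)) ^ 2 = (2 * R / (R + τ)) ^ 2 * (τ / R) := by
    field_simp
    ring
  rw [h1, h2, Real.sqrt_mul (by positivity), Real.sqrt_sq (by positivity)]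
  field_simp

theorem theorem7 :
    ∃ C : ℝ, 0 < C ∧
      ∀ (d : ℕ), 1 ≤ d →
      ∀ (c : EuclideanSpace ℝ (Fin d)) (r₁ r₂ : ℝ), 0 < r₁ → r₁ < r₂ →
      ∀ (S₁ S₂ Λ : Set (EuclideanSpace ℝ (Fin d))) (ρ : ℝ),
        S₁ = Metric.sphere c r₁ → S₂ = Metric.sphere c r₂ →
        Λ = decisionAxis ![S₁, S₂] → ρ = reach Λ (S₁ ∪ S₂) →
      ∀ (τ : ℝ), 0 ≤ τ → τ ≤ ρ →
      ∀ (f : ReLUNetwork d),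
        (CorrectlyClassifies f.toFun
            (Metric.cthickening (ρ - τ) S₁) (Metric.cthickening (ρ - τ) S₂) ∨
          (CorrectlyClassifies f.toFun S₁ S₂ ∧
            decisionBoundary f.toFun ⊆ Metric.cthickening τ Λ)) →
        -- for `d ≥ 2` the bounds are infinite at `τ = 0`, that is, no such network exists
        (2 ≤ d → 0 < τ) ∧
        2 * √Real.pi * (Real.Gamma (((d : ℝ) + 1) / 2) / Real.Gamma ((d : ℝ) / 2)) *
            ((r₁ + ρ) / (4 * τ)) ^ (((d : ℝ) - 1) / 2) ≤ (f.numLinearRegions : ℝ) ∧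
        C * (√(d : ℝ) / 2 ^ d * ((r₁ + ρ) / τ) ^ (((d : ℝ) - 1) / 2)) ≤
          (f.numLinearRegions : ℝ) := by
  refine ⟨2 * √Real.pi, by have := Real.pi_pos; positivity, ?_⟩
  rintro d hd c r₁ r₂ h₁ h₂ S₁ S₂ Λ ρ rfl rfl rfl hρ τ hτ hτρ f hclass
  rw [decisionAxis_sphere_sphere hd c h₁ h₂] at hclass hρ
  rw [reach_sphere_sphere hd c h₁ h₂] at hρ
  subst hρ
  have hsep := SeparatesInShell.of_correctlyClassifies h₁ h₂ hτ hτρ f.continuous_toFun hclass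
  rw [show r₁ + (r₂ - r₁) / 2 = (r₁ + r₂) / 2 by ring]
  set R := (r₁ + r₂) / 2 with hRdef
  have hτR : τ < R := by linarith
  have hR : 0 < R := hτ.trans_lt hτR
  have hgam := sqrt_div_two_le_Gamma_div_Gamma hd
  obtain ⟨n, rfl⟩ : ∃ n, d = n + 1 := ⟨d - 1, by omega⟩
  have hcount := f.unitBallVolume_le (by linarith) (by linarith) hsep
  rw [two_mul_sqrt_div_of_ratio hτ hτR] at hcount
  set γ := Real.Gamma (((n + 1 : ℕ) + 1 : ℝ) / 2) / Real.Gamma ((n + 1 : ℕ) / 2 : ℝ) with hγ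
  have hγ0 : 0 < γ := lt_of_lt_of_le (by positivity) hgam
  have hπ : 0 < √Real.pi := Real.sqrt_pos.2 Real.pi_pos
  -- Kept free of division by τ, so that it also covers τ = 0, where it is contradictory for n ≥ 1.
  have hbound : 2 * √Real.pi * γ ≤ f.numLinearRegions * (2 * √(τ / R)) ^ n := by
    refine le_of_mul_le_mul_right ?_ (unitBallVolume_pos n)
    rw [← unitBallVolume_succ]
    calc _ ≤ _ := mul_le_mul_of_nonneg_left hcount (by positivity : (0 : ℝ) ≤ n + 1)
      _ = _ := by field_simp
  have hexp : (((n + 1 : ℕ) : ℝ) - 1) / 2 = n / 2 := by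
    push_cast
    ring
  have hmain : 2 * √Real.pi * γ * (R / (4 * τ)) ^ ((n : ℝ) / 2) ≤ f.numLinearRegions := by
    rcases hτ.eq_or_lt with rfl | hτ0
    · rcases n with _ | n
      -- Here d = 1 and τ = 0: the base R / 0 is 0 and its power 0 ^ 0 is 1.
      · simpa using hbound
      · simp at hbound
        exact absurd hbound (not_le.2 (by positivity))
    · have hx : (R / (4 * τ)) ^ ((n : ℝ) / 2) = ((2 * √(τ / R)) ^ n)⁻¹ := by
        rw [Real.rpow_div_two_eq_sqrt _ (by positivity), Real.rpow_natCast, ← inv_pow]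
        congr 1
        rw [Real.sqrt_eq_iff_mul_self_eq_of_pos (by positivity), ← sq, inv_pow, mul_pow,
          Real.sq_sqrt (by positivity)]
        field_simp
        norm_num
      rw [hx, ← div_eq_mul_inv, div_le_iff₀ (by positivity)]
      exact hbound
  rw [hexp]
  refine ⟨fun h2 => hτ.lt_of_ne ?_, hmain, le_trans ?_ hmain⟩
  · rintro rfl
    have hn : n ≠ 0 := by omega
    simp [hn] at hbound
    exact absurd hbound (not_le.2 (by positivity))
  · have hx : (R / (4 * τ)) ^ ((n : ℝ) / 2) = (R / τ) ^ ((n : ℝ) / 2) / 2 ^ n := by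
      rw [mul_comm 4 τ, ← div_div R τ 4,
        Real.div_rpow (by positivity) (by norm_num), Real.rpow_div_two_eq_sqrt (x := 4) _ (by norm_num),
        Real.rpow_natCast, show (4 : ℝ) = 2 ^ 2 by norm_num, Real.sqrt_sq (by norm_num)]
    rw [hx]
    -- The 1/2 from γ ≥ √d / 2 turns 2 ^ n into 2 ^ d, so C = 2√π suffices.
    calc _ = 2 * √Real.pi * (√((n + 1 : ℕ) : ℝ) / 2) * ((R / τ) ^ ((n : ℝ) / 2) / 2 ^ n) := by
          rw [pow_succ]
          field_simp
      _ ≤ _ := by gcongr
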